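/- Let $A$ be one of the following unital complex Banach algebras of functions: $C(X)$, the continuous complex-valued functions on a compact Hausdorff space $X$ with the supremum norm $\|\cdot\|_X$; $\mathrm{Lip}(X)$, the complex-valued Lipschitz functions on a compact metric space $X$ with the norm $\|f\|=\|f\|_X+p(f)$, where $p(f)$ is the Lipschitz constant of $f$; or $\mathrm{AC}([0,1])$, the complex-valued absolutely continuous functions on $[0,1]$ with the norm $\|f\|=\|f\|_{[0,1]}+\mathrm{var}(f)$, where $\mathrm{var}(f)$ is the total variation of $f$. Let $\varphi\colon A\to\mathbb C$ be a multiplicative spectral function, that is, a function (not assumed to be linear or continuous) such that $\varphi(fg)=\varphi(f)\varphi(g)$ for all $f,g\in A$ and $\varphi(f)$ belongs to the spectrum $\sigma(f)$ of $f$ in $A$ for every $f\in A$. Then the following are equivalent: (i) $\varphi$ is a character of $A$, i.e. a nonzero multiplicative complex-linear functional; (ii) $\varphi$ is continuous with respect to the norm of $A$; (iii) $1\notin\mathrm{span}(\ker\varphi)$, where $\ker\varphi=\{f\in A:\varphi(f)=0\}$ and $\mathrm{span}$ denotes the complex linear span. -/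

import Mathlib

open scoped NNReal ENNReal

/-! ### Multiplicative spectral functions and characters -/

/-- A (not necessarily linear or continuous) function `φ : A → ℂ` on a complex algebra is a
multiplicative spectral function if it is multiplicative and `φ a` lies in the spectrum of `a`
in `A` for every `a`. -/
structure IsMultiplicativeSpectral {A : Type*} [CommRing A] [Algebra ℂ A] (φ : A → ℂ) : Prop where
  map_mul : ∀ a b : A, φ (a * b) = φ a * φ b
  mem_spectrum : ∀ a : A, φ a ∈ spectrum ℂ a

/-- A character: a nonzero multiplicative complex-linear functional. No continuity is required. -/
structure IsCharacter {A : Type*} [CommRing A] [Algebra ℂ A] (φ : A → ℂ) : Prop where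
  map_add : ∀ a b : A, φ (a + b) = φ a + φ b
  map_smul : ∀ (c : ℂ) (a : A), φ (c • a) = c * φ a
  map_mul : ∀ a b : A, φ (a * b) = φ a * φ b
  ne_zero : ∃ a : A, φ a ≠ 0

/-! ### Algebra norms of the form "sup norm plus seminorm" -/

/-- On a subalgebra `S` of `C(X, ℂ)`, the norm `f ↦ ‖f‖_X + p f`, where `p` is a seminorm with the
Leibniz property on `S`. -/
noncomputable def supAddRingNorm {X : Type*} [TopologicalSpace X] [CompactSpace X]
    (S : Subalgebra ℂ C(X, ℂ)) (p : C(X, ℂ) → ℝ)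
    (hnonneg : ∀ f ∈ S, 0 ≤ p f)
    (hadd : ∀ f ∈ S, ∀ g ∈ S, p (f + g) ≤ p f + p g)
    (hsmul : ∀ (c : ℂ), ∀ f ∈ S, p (c • f) ≤ ‖c‖ * p f)
    (hmul : ∀ f ∈ S, ∀ g ∈ S, p (f * g) ≤ ‖f‖ * p g + p f * ‖g‖) : RingNorm S where
  toFun f := ‖(f : C(X, ℂ))‖ + p f
  map_zero' := by
    have h0 := hnonneg 0 S.zero_mem
    have h1 := hsmul 0 0 S.zero_mem
    simp only [norm_zero, zero_mul, smul_zero] at h1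
    simp [le_antisymm h1 h0]
  add_le' f g := by
    have h1 := norm_add_le (f : C(X, ℂ)) g
    have h2 := hadd f f.2 g g.2
    simp only [S.coe_add]
    linarith
  neg' f := by
    have h1 := hsmul (-1) f f.2
    have h2 := hsmul (-1) (-f : C(X, ℂ)) (S.neg_mem f.2)
    simp only [norm_neg, norm_one, one_mul, neg_smul, one_smul, neg_neg] at h1 h2
    simp [le_antisymm h1 h2]
  mul_le' f g := by
    have h1 := norm_mul_le (f : C(X, ℂ)) g
    have h2 := hmul f f.2 g g.2
    have h3 := mul_nonneg (hnonneg f f.2) (hnonneg g g.2)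
    simp only [S.coe_mul]
    nlinarith
  eq_zero_of_map_eq_zero' f hf := by
    have h1 := hnonneg f f.2
    have h2 := norm_nonneg (f : C(X, ℂ))
    have h3 : ‖(f : C(X, ℂ))‖ = 0 := by
      have : ‖(f : C(X, ℂ))‖ + p f = 0 := hf
      linarith
    exact Subtype.ext (norm_eq_zero.mp h3)

/-! ### The algebra of complex Lipschitz functions on a compact metric space -/

section Lip

variable {X : Type*} [MetricSpace X]

/-- The Lipschitz constant of `f`: the least `K ≥ 0` with `|f x - f y| ≤ K d(x, y)` for all
`x, y`. -/
noncomputable def lipConst (f : C(X, ℂ)) : ℝ≥0 := sInf {K : ℝ≥0 | LipschitzWith K f}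

theorem lipConst_le {f : C(X, ℂ)} {K : ℝ≥0} (h : LipschitzWith K f) : lipConst f ≤ K :=
  csInf_le' h

variable [CompactSpace X]

theorem LipschitzWith.continuousMap_mul {f g : C(X, ℂ)} {K L : ℝ≥0} (hf : LipschitzWith K f)
    (hg : LipschitzWith L g) : LipschitzWith (‖f‖₊ * L + K * ‖g‖₊) (f * g : C(X, ℂ)) := by
  refine LipschitzWith.of_dist_le_mul fun x y => ?_
  have h1 := hf.dist_le_mul x y
  have h2 := hg.dist_le_mul x y
  have h3 := f.norm_coe_le_norm x
  have h4 := g.norm_coe_le_norm y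
  rw [dist_eq_norm] at h1 h2 ⊢
  have e : (f * g) x - (f * g) y = f x * (g x - g y) + (f x - f y) * g y := by
    simp only [ContinuousMap.mul_apply]; ring
  rw [e]
  refine (norm_add_le _ _).trans ?_
  rw [norm_mul, norm_mul]
  push_cast
  calc ‖f x‖ * ‖g x - g y‖ + ‖f x - f y‖ * ‖g y‖
      ≤ ‖f‖ * (L * dist x y) + (K * dist x y) * ‖g‖ := by gcongr
    _ = (‖f‖ * L + K * ‖g‖) * dist x y := by ring

variable (X) in
/-- The complex Lipschitz functions on `X`, as a subalgebra of `C(X, ℂ)`. -/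
def lipSubalgebra : Subalgebra ℂ C(X, ℂ) where
  carrier := {f | ∃ K : ℝ≥0, LipschitzWith K f}
  mul_mem' := by
    rintro f g ⟨K, hK⟩ ⟨L, hL⟩
    exact ⟨_, hK.continuousMap_mul hL⟩
  add_mem' := by
    rintro f g ⟨K, hK⟩ ⟨L, hL⟩
    exact ⟨K + L, hK.add hL⟩
  algebraMap_mem' c := ⟨0, LipschitzWith.const c⟩

theorem lipschitzWith_lipConst {f : C(X, ℂ)} (hf : f ∈ lipSubalgebra X) :
    LipschitzWith (lipConst f) f := by
  intro x y
  rcases eq_or_ne x y with rfl | h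
  · simp
  · have h0 : nndist x y ≠ 0 := by simpa using h
    have : nndist (f x) (f y) / nndist x y ≤ lipConst f := by
      refine le_csInf hf fun K hK => ?_
      exact div_le_of_le_mul₀ zero_le zero_le (LipschitzWith.nndist_le hK x y)
    rw [edist_nndist, edist_nndist]
    exact_mod_cast (div_le_iff₀ (pos_iff_ne_zero.mpr h0)).mp this

theorem lipConst_smul_le (c : ℂ) {f : C(X, ℂ)} (hf : f ∈ lipSubalgebra X) :
    lipConst (c • f) ≤ ‖c‖₊ * lipConst f :=
  lipConst_le ((lipschitzWith_smul c).comp (lipschitzWith_lipConst hf))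

variable (X) in
/-- The norm `‖f‖ = ‖f‖_X + p(f)` on `Lip(X)`, where `p(f)` is the Lipschitz constant of `f`. -/
noncomputable def lipNorm : RingNorm (lipSubalgebra X) :=
  supAddRingNorm (lipSubalgebra X) (fun f => (lipConst f : ℝ))
    (fun _ _ => NNReal.coe_nonneg _)
    (fun _ hf _ hg => mod_cast
      lipConst_le ((lipschitzWith_lipConst hf).add (lipschitzWith_lipConst hg)))
    (fun c _ hf => mod_cast lipConst_smul_le c hf)
    (fun _ hf _ hg => mod_cast
      lipConst_le ((lipschitzWith_lipConst hf).continuousMap_mul (lipschitzWith_lipConst hg)))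

variable (X) in
/-- The Banach algebra `Lip(X)` of complex Lipschitz functions on `X`; a type synonym of the
subalgebra, so that it carries its own norm instead of the supremum norm. -/
def Lip : Type _ := lipSubalgebra X

noncomputable instance : NormedCommRing (Lip X) :=
  { (lipNorm X).toNormedRing with
    mul_comm := fun f g : lipSubalgebra X => mul_comm f g }

noncomputable instance : Algebra ℂ (Lip X) := inferInstanceAs (Algebra ℂ (lipSubalgebra X))

theorem Lip.norm_def (f : Lip X) : ‖f‖ = ‖(f.1 : C(X, ℂ))‖ + (lipConst f.1 : ℝ) := rfl

noncomputable instance : NormedAlgebra ℂ (Lip X) where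
  norm_smul_le c f := by
    have h1 := norm_smul_le c (f.1 : C(X, ℂ))
    have h2 : (lipConst (c • f.1) : ℝ) ≤ ‖c‖ * lipConst f.1 :=
      mod_cast lipConst_smul_le c f.2
    calc ‖c • f‖ = ‖c • f.1‖ + (lipConst (c • f.1) : ℝ) := rfl
      _ ≤ ‖c‖ * ‖f.1‖ + ‖c‖ * lipConst f.1 := add_le_add h1 h2
      _ = ‖c‖ * ‖f‖ := by rw [Lip.norm_def]; ring

end Lip

/-! ### The algebra of complex absolutely continuous functions on `[0, 1]` -/

section AC

/-- The complex absolutely continuous functions on `[0, 1]`, as a subalgebra of `C([0, 1], ℂ)`.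
Absolute continuity on `[0, 1]` only involves the values of the extension there. -/
def acSubalgebra : Subalgebra ℂ C(Set.Icc (0 : ℝ) 1, ℂ) where
  carrier := {f | AbsolutelyContinuousOnInterval (Set.IccExtend zero_le_one f) 0 1}
  mul_mem' {f g} hf hg := by
    have h := AbsolutelyContinuousOnInterval.smul (M := ℂ) (F := ℂ)
      (f := Set.IccExtend zero_le_one f) (g := Set.IccExtend zero_le_one g) hf hg
    exact h
  add_mem' {f g} hf hg := by
    have h := AbsolutelyContinuousOnInterval.add
      (f := Set.IccExtend zero_le_one f) (g := Set.IccExtend zero_le_one g) hf hg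
    exact h
  algebraMap_mem' c :=
    ((LipschitzWith.const c).lipschitzOnWith).absolutelyContinuousOnInterval

/-- The total variation of `f` on `[0, 1]`. -/
noncomputable def totalVar (f : C(Set.Icc (0 : ℝ) 1, ℂ)) : ℝ :=
  (eVariationOn f Set.univ).toReal

theorem eVariationOn_ne_top_of_mem_acSubalgebra {f : C(Set.Icc (0 : ℝ) 1, ℂ)}
    (hf : f ∈ acSubalgebra) : eVariationOn f Set.univ ≠ ∞ := by
  have h1 : BoundedVariationOn (Set.IccExtend zero_le_one f) (Set.uIcc (0 : ℝ) 1) :=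
    AbsolutelyContinuousOnInterval.boundedVariationOn hf
  have h2 : eVariationOn (Set.IccExtend zero_le_one f ∘ Subtype.val) Set.univ ≤
      eVariationOn (Set.IccExtend zero_le_one f) (Set.uIcc (0 : ℝ) 1) :=
    eVariationOn.comp_le_of_monotoneOn _ _ (fun _ _ _ _ h => h)
      (fun x _ => by rw [Set.uIcc_of_le zero_le_one]; exact x.2)
  have h3 : Set.IccExtend zero_le_one f ∘ Subtype.val = f := by
    ext x; simp
  rw [h3] at h2
  exact ne_top_of_le_ne_top h1 h2

theorem totalVar_nonneg (f : C(Set.Icc (0 : ℝ) 1, ℂ)) : 0 ≤ totalVar f := ENNReal.toReal_nonneg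

theorem totalVar_add_le {f g : C(Set.Icc (0 : ℝ) 1, ℂ)} (hf : f ∈ acSubalgebra)
    (hg : g ∈ acSubalgebra) : totalVar (f + g) ≤ totalVar f + totalVar g := by
  have hf' := eVariationOn_ne_top_of_mem_acSubalgebra hf
  have hg' := eVariationOn_ne_top_of_mem_acSubalgebra hg
  unfold totalVar
  rw [← ENNReal.toReal_add hf' hg']
  refine ENNReal.toReal_mono (by finiteness) (iSup_le fun p => ?_)
  refine le_trans ?_ (add_le_add (eVariationOn.sum_le p.2.2.1 p.2.2.2 (n := p.1))
    (eVariationOn.sum_le p.2.2.1 p.2.2.2 (n := p.1)))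
  rw [← Finset.sum_add_distrib]
  exact Finset.sum_le_sum fun i _ => edist_add_add_le _ _ _ _

theorem totalVar_mul_le {f g : C(Set.Icc (0 : ℝ) 1, ℂ)} (hf : f ∈ acSubalgebra)
    (hg : g ∈ acSubalgebra) : totalVar (f * g) ≤ ‖f‖ * totalVar g + totalVar f * ‖g‖ := by
  have hf' := eVariationOn_ne_top_of_mem_acSubalgebra hf
  have hg' := eVariationOn_ne_top_of_mem_acSubalgebra hg
  have key : eVariationOn (f * g : C(Set.Icc (0 : ℝ) 1, ℂ)) Set.univ ≤
      ‖f‖ₑ * eVariationOn g Set.univ + ‖g‖ₑ * eVariationOn f Set.univ :=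
    eVariationOn_smul_le
      (fun x _ => enorm_le_iff_norm_le.mpr (f.norm_coe_le_norm x))
      (fun x _ => enorm_le_iff_norm_le.mpr (g.norm_coe_le_norm x))
  have h := ENNReal.toReal_mono (by finiteness) key
  rw [ENNReal.toReal_add (by finiteness) (by finiteness), ENNReal.toReal_mul,
    ENNReal.toReal_mul, toReal_enorm, toReal_enorm] at h
  unfold totalVar
  linarith

theorem totalVar_smul_le (c : ℂ) {f : C(Set.Icc (0 : ℝ) 1, ℂ)} (hf : f ∈ acSubalgebra) :
    totalVar (c • f) ≤ ‖c‖ * totalVar f := by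
  have hf' := eVariationOn_ne_top_of_mem_acSubalgebra hf
  have key : eVariationOn (c • f : C(Set.Icc (0 : ℝ) 1, ℂ)) Set.univ ≤
      (‖c‖₊ : ℝ≥0∞) * eVariationOn f Set.univ :=
    ((lipschitzWith_smul c).lipschitzOnWith (s := Set.univ)).comp_eVariationOn_le
      (fun _ _ => Set.mem_univ _)
  have h := ENNReal.toReal_mono (by finiteness) key
  rwa [ENNReal.toReal_mul] at h

/-- The norm `‖f‖ = ‖f‖_[0,1] + var(f)` on `AC([0, 1])`. -/
noncomputable def acNorm : RingNorm acSubalgebra :=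
  supAddRingNorm acSubalgebra totalVar
    (fun f _ => totalVar_nonneg f)
    (fun _ hf _ hg => totalVar_add_le hf hg)
    (fun c _ hf => totalVar_smul_le c hf)
    (fun _ hf _ hg => totalVar_mul_le hf hg)

/-- The Banach algebra `AC([0, 1])` of complex absolutely continuous functions on `[0, 1]`; a type
synonym of the subalgebra, so that it carries its own norm instead of the supremum norm. -/
def AC : Type := acSubalgebra

noncomputable instance : NormedCommRing AC :=
  { acNorm.toNormedRing with
    mul_comm := fun f g : acSubalgebra => mul_comm f g }

noncomputable instance : Algebra ℂ AC := inferInstanceAs (Algebra ℂ acSubalgebra)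

theorem AC.norm_def (f : AC) : ‖f‖ = ‖(f.1 : C(Set.Icc (0 : ℝ) 1, ℂ))‖ + totalVar f.1 := rfl

noncomputable instance : NormedAlgebra ℂ AC where
  norm_smul_le c f := by
    have h1 := norm_smul_le c (f.1 : C(Set.Icc (0 : ℝ) 1, ℂ))
    have h2 := totalVar_smul_le c f.2
    calc ‖c • f‖ = ‖c • f.1‖ + totalVar (c • f.1) := rfl
      _ ≤ ‖c‖ * ‖f.1‖ + ‖c‖ * totalVar f.1 := add_le_add h1 h2
      _ = ‖c‖ * ‖f‖ := by rw [AC.norm_def]; ring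

end AC

/-! Only a few features common to the three algebras matter: they are point-separating,
inverse-closed function algebras on a compact space, stable under Lipschitz functional calculus.
Spectral values are then values of the function, so `φ f` is `f` evaluated at a point that may
depend on `f`. The task is to make that point independent of `f`; each condition turns out to say
that `φ` is an evaluation.

By `eq_eval`, it suffices to find `x` such that `φ` kills no nonnegative function with value `1` at
`x`. If `1` is outside the span of the kernel, compactness yields a common zero of the kernel, and
this `x` works. If `φ` is continuous, `x` is found from exponentials. The main step,
`map_exp_sq_eq_one`, shows that `φ (exp g) = 1` with `g` real forces `φ (exp (g ^ 2)) = 1`. So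
nonnegative functions suffice to locate `x`, and these have a common zero by compactness. Continuity
carries the formula from positive functions, which are exponentials, to nonnegative ones. -/

section FunctionAlgebra

/-! ### Regular function algebras: spectra, common zeros and cut-offs -/

/-- `ι` realises `A` as a regular algebra of continuous functions on `X` which is closed under
composition with locally Lipschitz functions on the left. -/
structure IsRegularFunctionAlgebra {A X : Type*} [CommRing A] [Algebra ℂ A] [TopologicalSpace X]
    (ι : A →ₐ[ℂ] C(X, ℂ)) : Prop where
  injective : Function.Injective ι
  exists_comp : ∀ (f : A) (h : ℂ → ℂ), LocallyLipschitzOn (Set.range (ι f)) h →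
    ∃ g : A, ∀ x, ι g x = h (ι f x)
  exists_separating : ∀ (x : X), ∀ U ∈ nhds x, ∃ d : A, ι d x = 0 ∧ ∀ y ∉ U, 1 ≤ (ι d y).re

theorem Complex.locallyLipschitzOn_inv {s : Set ℂ} (hs : (0 : ℂ) ∉ s) :
    LocallyLipschitzOn s (fun z : ℂ => z⁻¹) := by
  intro z hz
  have hz0 : z ≠ 0 := fun h => hs (h ▸ hz)
  obtain ⟨K, t, ht, hK⟩ := (contDiffAt_inv ℂ hz0 (n := 1)).exists_lipschitzOnWith
  exact ⟨K, t, mem_nhdsWithin_of_mem_nhds ht, hK⟩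

theorem Complex.locallyLipschitzOn_exp (s : Set ℂ) : LocallyLipschitzOn s Complex.exp :=
  (Complex.contDiff_exp (𝕜 := ℂ) (n := 1)).locallyLipschitz.locallyLipschitzOn

theorem Complex.locallyLipschitzOn_log {s : Set ℂ} (hs : s ⊆ Complex.slitPlane) :
    LocallyLipschitzOn s Complex.log := by
  intro z hz
  obtain ⟨K, t, ht, hK⟩ := (Complex.contDiffAt_log (hs hz) (n := 1)).exists_lipschitzOnWith
  exact ⟨K, t, mem_nhdsWithin_of_mem_nhds ht, hK⟩

variable {A X : Type*} [CommRing A] [Algebra ℂ A] [TopologicalSpace X] {ι : A →ₐ[ℂ] C(X, ℂ)}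

/-- The elements of `A` represented by nonnegative real functions. -/
def IsNonnegFunction (ι : A →ₐ[ℂ] C(X, ℂ)) (f : A) : Prop :=
  ∀ x, ∃ r : ℝ, 0 ≤ r ∧ ι f x = r

theorem IsNonnegFunction.add {f g : A} (hf : IsNonnegFunction ι f) (hg : IsNonnegFunction ι g) :
    IsNonnegFunction ι (f + g) := by
  intro x
  obtain ⟨r, hr, hr'⟩ := hf x
  obtain ⟨s, hs, hs'⟩ := hg x
  exact ⟨r + s, by positivity, by simp [hr', hs']⟩

/-- A nonempty additively closed family of nonnegative functions, each of which has a zero, has a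
common zero. -/
theorem exists_common_zero [CompactSpace X] {S : Set A} (hne : S.Nonempty)
    (hnonneg : ∀ f ∈ S, IsNonnegFunction ι f) (hadd : ∀ f ∈ S, ∀ g ∈ S, f + g ∈ S)
    (hzero : ∀ f ∈ S, ∃ x, ι f x = 0) : ∃ x, ∀ f ∈ S, ι f x = 0 := by
  have : Nonempty S := hne.to_subtype
  have hclosed : ∀ f : S, IsClosed {x | ι f.1 x = 0} := fun f =>
    isClosed_eq (ι f.1).continuous continuous_const
  obtain ⟨x, hx⟩ := IsCompact.nonempty_iInter_of_directed_nonempty_isCompact_isClosed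
    (fun f : S => {x | ι f.1 x = 0})
    (by
      rintro ⟨f, hf⟩ ⟨g, hg⟩
      refine ⟨⟨f + g, hadd f hf g hg⟩, ?_, ?_⟩ <;>
      · intro x hx
        obtain ⟨r, hr, hr'⟩ := hnonneg f hf x
        obtain ⟨s, hs, hs'⟩ := hnonneg g hg x
        simp only [Set.mem_ofPred_eq, map_add, ContinuousMap.add_apply, hr', hs'] at hx ⊢
        norm_cast at hx ⊢
        linarith)
    (fun f => hzero f.1 f.2) (fun f => (hclosed f).isCompact) hclosed
  exact ⟨x, fun f hf => Set.mem_iInter.mp hx ⟨f, hf⟩⟩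

namespace IsRegularFunctionAlgebra

theorem exists_inv (hι : IsRegularFunctionAlgebra ι) {f : A} (hf : ∀ x, ι f x ≠ 0) :
    ∃ g : A, g * f = 1 := by
  obtain ⟨g, hg⟩ := hι.exists_comp f (fun z => z⁻¹)
    (Complex.locallyLipschitzOn_inv (by rintro ⟨x, hx⟩; exact hf x hx))
  refine ⟨g, hι.injective (ContinuousMap.ext fun x => ?_)⟩
  simp [hg, hf x]

/-- A function without zeros is invertible in `A` itself, since inversion is locally Lipschitz away
from `0`. -/
theorem exists_eq_of_mem_spectrum (hι : IsRegularFunctionAlgebra ι) {f : A} {c : ℂ}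
    (hc : c ∈ spectrum ℂ f) : ∃ x, ι f x = c := by
  by_contra! h
  obtain ⟨g, hg⟩ := hι.exists_inv (f := algebraMap ℂ A c - f)
    (fun x => by simpa [AlgHomClass.commutes, sub_eq_zero] using (h x).symm)
  exact hc (IsUnit.of_mul_eq_one g (by rw [mul_comm, hg]))

theorem exists_conj (hι : IsRegularFunctionAlgebra ι) (f : A) :
    ∃ g : A, ∀ x, ι g x = starRingEnd ℂ (ι f x) :=
  hι.exists_comp f _ (Complex.isometry_conj.lipschitz.locallyLipschitz.locallyLipschitzOn)

/-- A proper ideal has a common zero. -/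
theorem exists_common_zero_of_ideal (hι : IsRegularFunctionAlgebra ι) [CompactSpace X]
    {J : Ideal A} (hJ : (1 : A) ∉ J) : ∃ x, ∀ f ∈ J, ι f x = 0 := by
  obtain ⟨x, hx⟩ := exists_common_zero (ι := ι) (S := {f | f ∈ J ∧ IsNonnegFunction ι f})
    ⟨0, J.zero_mem, fun x => ⟨0, le_rfl, by simp⟩⟩ (fun f hf => hf.2)
    (fun f hf g hg => ⟨J.add_mem hf.1 hg.1, hf.2.add hg.2⟩)
    (fun f hf => by
      by_contra! h
      obtain ⟨g, hg⟩ := hι.exists_inv h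
      exact hJ (hg ▸ J.mul_mem_left g hf.1))
  refine ⟨x, fun f hf => ?_⟩
  obtain ⟨g, hg⟩ := hι.exists_conj f
  -- The function `|f| ^ 2` lies in the ideal, is nonnegative, and has the same zeros as `f`.
  have := hx (g * f) ⟨J.mul_mem_left g hf, fun y => ⟨Complex.normSq (ι f y),
    Complex.normSq_nonneg _, by simp [hg, Complex.normSq_eq_conj_mul_self]⟩⟩
  simpa [hg] using this

/-- Cut-off functions: `u` takes values in `[0, 1]`, vanishes off `U`, and is `1` wherever the
nonnegative function `e` does not vanish. -/
theorem exists_cutoff (hι : IsRegularFunctionAlgebra ι) {x : X} {U : Set X} (hU : U ∈ nhds x) :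
    ∃ e u : A, IsNonnegFunction ι e ∧ ι e x = 1 ∧ e * u = e ∧ (∀ y ∉ U, ι u y = 0) ∧
      ∀ y, ‖ι u y‖ ≤ 1 := by
  obtain ⟨d, hdx, hd⟩ := hι.exists_separating x U hU
  have hre : LipschitzWith 1 Complex.re := LipschitzWith.mk_one fun z w => by
    simpa [dist_eq_norm] using Complex.abs_re_le_norm (z - w)
  have hlip (c : ℝ) : LipschitzWith (0 + 2 * 1) (fun z : ℂ => max (c - 2 * z.re) 0) := by
    refine LipschitzWith.max_const (LipschitzWith.sub (LipschitzWith.const c) ?_) 0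
    have h2 : LipschitzWith 2 (fun t : ℝ => 2 * t) := by
      simpa using lipschitzWith_smul (β := ℝ) (2 : ℝ)
    exact h2.comp hre
  have hof : LipschitzWith 1 Complex.ofReal := Complex.isometry_ofReal.lipschitz
  -- With `t = Re d`, take `e = max (1 - 2t) 0` and `u = min (max (2 - 2t) 0) 1`. If `e ≠ 0` then `t
  -- < 1/2`, so `u = 1`; off `U`, `t ≥ 1` gives `u = 0`.
  obtain ⟨e, he⟩ := hι.exists_comp d _ (hof.comp (hlip 1)).locallyLipschitz.locallyLipschitzOn
  obtain ⟨u, hu⟩ := hι.exists_comp d _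
    (hof.comp ((hlip 2).min_const 1)).locallyLipschitz.locallyLipschitzOn
  simp only [Function.comp_apply] at he hu
  refine ⟨e, u, fun y => ⟨_, le_max_right _ _, he y⟩, by simp [he, hdx],
    hι.injective (ContinuousMap.ext fun y => ?_), fun y hy => ?_, fun y => ?_⟩
  · simp only [map_mul, ContinuousMap.mul_apply, he, hu]
    norm_cast
    rcases le_total ((1 : ℝ) - 2 * (ι d y).re) 0 with h | h
    · rw [max_eq_right h, zero_mul]
    · rw [min_eq_right (le_max_of_le_left (by linarith)), mul_one]
  · have := hd y hy
    rw [hu, max_eq_right (by linarith), min_eq_left zero_le_one, Complex.ofReal_zero]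
  · rw [hu, Complex.norm_real, Real.norm_eq_abs, abs_le]
    exact ⟨by linarith [le_min (le_max_right (2 - 2 * (ι d y).re) 0) zero_le_one],
      min_le_right _ _⟩

end IsRegularFunctionAlgebra

/-! ### Multiplicative spectral functions and point evaluations -/

namespace IsMultiplicativeSpectral

variable {φ : A → ℂ}

theorem exists_apply_eq (hφ : IsMultiplicativeSpectral φ) (hι : IsRegularFunctionAlgebra ι)
    (f : A) : ∃ x, ι f x = φ f :=
  hι.exists_eq_of_mem_spectrum (hφ.mem_spectrum f)

theorem map_algebraMap (hφ : IsMultiplicativeSpectral φ) (hι : IsRegularFunctionAlgebra ι)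
    (c : ℂ) : φ (algebraMap ℂ A c) = c := by
  obtain ⟨x, hx⟩ := hφ.exists_apply_eq hι (algebraMap ℂ A c)
  simpa [AlgHomClass.commutes] using hx.symm

theorem map_one (hφ : IsMultiplicativeSpectral φ) (hι : IsRegularFunctionAlgebra ι) :
    φ 1 = 1 := by
  simpa using hφ.map_algebraMap hι 1

theorem map_pow (hφ : IsMultiplicativeSpectral φ) (hι : IsRegularFunctionAlgebra ι) (f : A)
    (n : ℕ) : φ (f ^ n) = φ f ^ n := by
  induction n with
  | zero => simp [hφ.map_one hι]
  | succ n ih => rw [pow_succ, hφ.map_mul, ih, pow_succ]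

/-- If `φ` does not vanish at the nonnegative functions with value `1` at `x`, then `φ f` only
depends on the germ of `f` at `x`, and therefore `φ` is the evaluation at `x`. -/
theorem eq_eval (hφ : IsMultiplicativeSpectral φ) (hι : IsRegularFunctionAlgebra ι) {x : X}
    (hx : ∀ e, IsNonnegFunction ι e → ι e x = 1 → φ e ≠ 0) (f : A) : φ f = ι f x := by
  rw [← sub_eq_zero, ← norm_le_zero_iff]
  refine le_of_forall_pos_le_add fun ε hε => ?_
  have hU : {y | dist (ι f y) (ι f x) < ε} ∈ nhds x :=
    (ι f).continuous.continuousAt (Metric.ball_mem_nhds _ hε)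
  obtain ⟨e, u, he, hex, heu, hu, hu1⟩ := hι.exists_cutoff hU
  set c := algebraMap ℂ A (ι f x) with hc
  -- The function `c + u * (f - c)` agrees with `f` where `e ≠ 0` and is within `ε` of `f x`
  -- everywhere. Cancelling `φ e` transfers this bound to `φ f`.
  have hmul : e * f = e * (c + u * (f - c)) := by
    linear_combination (c - f) * heu
  have hφf : φ f = φ (c + u * (f - c)) := by
    have := congrArg φ hmul
    rw [hφ.map_mul, hφ.map_mul] at this
    exact mul_left_cancel₀ (hx e he hex) this
  obtain ⟨y, hy⟩ := hφ.exists_apply_eq hι (c + u * (f - c))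
  have hy' : φ f - ι f x = ι u y * (ι f y - ι f x) := by
    rw [hφf, ← hy]
    simp [hc, AlgHomClass.commutes]
  rw [hy', norm_mul, zero_add]
  by_cases hyU : dist (ι f y) (ι f x) < ε
  · rw [← dist_eq_norm]
    exact (mul_le_of_le_one_left dist_nonneg (hu1 y)).trans hyU.le
  · rw [hu y hyU]
    simpa using hε.le

/-- Multiplicativity makes the kernel stable under multiplication by `A`, so the ideal it generates
is no larger than its linear span and hence is proper. -/
theorem exists_eq_eval_of_one_notMem_span [CompactSpace X] (hφ : IsMultiplicativeSpectral φ)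
    (hι : IsRegularFunctionAlgebra ι) (h : (1 : A) ∉ Submodule.span ℂ {f | φ f = 0}) :
    ∃ x, ∀ f, φ f = ι f x := by
  have hsub : ∀ f ∈ Ideal.span {f | φ f = 0}, f ∈ Submodule.span ℂ {f | φ f = 0} := by
    intro f hf
    induction hf using Submodule.closure_induction with
    | zero => exact Submodule.zero_mem _
    | add f g _ _ hf hg => exact Submodule.add_mem _ hf hg
    | smul_mem a f hf =>
      refine Submodule.subset_span ?_
      simp only [Set.mem_ofPred_eq] at hf
      simp [hφ.map_mul, hf]
  obtain ⟨x, hx⟩ := hι.exists_common_zero_of_ideal (fun h1 => h (hsub 1 h1))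
  refine ⟨x, hφ.eq_eval hι fun e _ he h0 => ?_⟩
  rw [hx e (Ideal.subset_span h0)] at he
  exact zero_ne_one he

/-! ### Values on exponentials -/

section Exp

variable {E : A → A}

theorem map_exp_add (hφ : IsMultiplicativeSpectral φ) (hι : IsRegularFunctionAlgebra ι)
    (hE : ∀ f x, ι (E f) x = Complex.exp (ι f x)) (f g : A) :
    φ (E (f + g)) = φ (E f) * φ (E g) := by
  rw [← hφ.map_mul]
  congr 1
  exact hι.injective (ContinuousMap.ext fun x => by simp [hE, Complex.exp_add])

theorem map_exp_nsmul (hφ : IsMultiplicativeSpectral φ) (hι : IsRegularFunctionAlgebra ι)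
    (hE : ∀ f x, ι (E f) x = Complex.exp (ι f x)) (f : A) (n : ℕ) :
    φ (E (n • f)) = φ (E f) ^ n := by
  rw [← hφ.map_pow hι]
  congr 1
  exact hι.injective (ContinuousMap.ext fun x => by simp [hE, Complex.exp_nat_mul])

theorem exists_map_exp_eq (hφ : IsMultiplicativeSpectral φ) (hι : IsRegularFunctionAlgebra ι)
    (hE : ∀ f x, ι (E f) x = Complex.exp (ι f x)) (f : A) :
    ∃ x, φ (E f) = Complex.exp (ι f x) := by
  obtain ⟨x, hx⟩ := hφ.exists_apply_eq hι (E f)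
  exact ⟨x, by rw [← hx, hE]⟩

/-- For small real `k`, the values of `φ` at `exp k` and `exp (i k)` come from a common point. -/
theorem exists_map_exp_I_smul (hφ : IsMultiplicativeSpectral φ)
    (hι : IsRegularFunctionAlgebra ι) (hE : ∀ f x, ι (E f) x = Complex.exp (ι f x)) {k : A}
    (hk : ∀ x, ((ι k x).re : ℂ) = ι k x) :
    ∃ x, φ (E k) = Complex.exp (ι k x) ∧
      φ (E (Complex.I • k)) = Complex.exp (Complex.I * ι k x) := by
  obtain ⟨x, hx⟩ := hφ.exists_map_exp_eq hι hE (k + Complex.I • k)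
  obtain ⟨y, hy⟩ := hφ.exists_map_exp_eq hι hE k
  obtain ⟨z, hz⟩ := hφ.exists_map_exp_eq hι hE (Complex.I • k)
  have h := hφ.map_exp_add hι hE k (Complex.I • k)
  -- Compare moduli in `φ (exp (k + ik)) = φ (exp k) * φ (exp (ik))`: the last factor has modulus
  -- `1`.
  have hre : (ι k y).re = (ι k x).re := by
    have := congrArg norm h
    rw [hx, hy, hz, norm_mul, Complex.norm_exp, Complex.norm_exp, Complex.norm_exp] at this
    simp only [map_add, map_smul, ContinuousMap.add_apply, ContinuousMap.smul_apply,
      smul_eq_mul] at this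
    rw [← hk x, ← hk y, ← hk z] at this
    simpa using this.symm
  have hyx : ι k y = ι k x := by rw [← hk y, ← hk x, hre]
  refine ⟨x, by rw [hy, hyx], ?_⟩
  rw [hx, hy, hyx] at h
  simp only [map_add, map_smul, ContinuousMap.add_apply, ContinuousMap.smul_apply,
      smul_eq_mul, Complex.exp_add] at h
  exact (mul_left_cancel₀ (Complex.exp_ne_zero _) h).symm

/-- Put `k = g ^ 2 / n` and consider `exp (g + ik)`. Its image under `φ` is unimodular, so it is
attained at a zero of `g`, hence of `k`, and equals `1`. Thus `φ (exp (ik)) = 1`, and the common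
point for `exp k` and `exp (ik)` gives `φ (exp k) = 1`. -/
theorem map_exp_sq_eq_one [CompactSpace X] (hφ : IsMultiplicativeSpectral φ)
    (hι : IsRegularFunctionAlgebra ι) (hE : ∀ f x, ι (E f) x = Complex.exp (ι f x)) {g : A}
    (hg : ∀ x, ((ι g x).re : ℂ) = ι g x) (h1 : φ (E g) = 1) : φ (E (g ^ 2)) = 1 := by
  -- This size of `n` keeps `k` in `[0, 1)`, inside the principal range of the argument, so that
  -- `exp (ik) = 1` forces `k = 0`.
  obtain ⟨n, hn⟩ := exists_nat_gt (‖ι g‖ ^ 2)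
  have hn0 : (0 : ℝ) < n := lt_of_le_of_lt (by positivity) hn
  have hnC : (n : ℂ) ≠ 0 := by exact_mod_cast hn0.ne'
  set k : A := (n : ℂ)⁻¹ • g ^ 2 with hkdef
  have hkx (x : X) : ι k x = (((ι g x).re ^ 2 / n : ℝ) : ℂ) := by
    rw [hkdef]
    simp only [map_smul, _root_.map_pow, ContinuousMap.smul_apply, ContinuousMap.pow_apply,
      smul_eq_mul]
    rw [← hg x]
    push_cast
    simp only [Complex.ofReal_re]
    field_simp
  have hk1 (x : X) : (ι g x).re ^ 2 / n < 1 := by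
    rw [div_lt_one hn0]
    refine lt_of_le_of_lt ?_ hn
    rw [← sq_abs]
    gcongr
    exact (Complex.abs_re_le_norm _).trans ((ι g).norm_coe_le_norm x)
  have hk0 (x : X) : 0 ≤ (ι g x).re ^ 2 / n := by positivity
  have hnk : n • k = g ^ 2 := by
    rw [hkdef, ← Nat.cast_smul_eq_nsmul ℂ, smul_smul, mul_inv_cancel₀ hnC, one_smul]
  obtain ⟨z, hz, hz'⟩ := hφ.exists_map_exp_I_smul hι hE (k := k)
    (fun x => by rw [hkx, Complex.ofReal_re])
  obtain ⟨w, hw⟩ := hφ.exists_map_exp_eq hι hE (g + Complex.I • k)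
  rw [hφ.map_exp_add hι hE, h1, one_mul, hz'] at hw
  simp only [map_add, map_smul, ContinuousMap.add_apply, ContinuousMap.smul_apply,
    smul_eq_mul] at hw
  rw [hkx, hkx, ← hg w, mul_comm Complex.I, mul_comm Complex.I] at hw
  have hgw : (ι g w).re = 0 := by
    have := congrArg norm hw
    rw [Complex.norm_exp, Complex.norm_exp] at this
    simp only [Complex.add_re, Complex.ofReal_re, Complex.re_ofReal_mul, Complex.I_re, mul_zero,
      add_zero, Real.exp_zero] at this
    exact (Real.exp_eq_one_iff _).mp this.symm
  have hkz : (ι g z).re ^ 2 / n = 0 := by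
    rw [hgw, Complex.ofReal_zero, zero_add, Complex.zero_re, zero_pow two_ne_zero, zero_div] at hw
    have hz1 := hk1 z
    have hz0 := hk0 z
    have hπ := Real.pi_gt_three
    have := congrArg Complex.arg hw
    rwa [Complex.arg_exp_mul_I, Complex.arg_exp_mul_I,
      (toIocMod_eq_self _).mpr ⟨by linarith, by linarith⟩,
      (toIocMod_eq_self _).mpr ⟨by linarith, by linarith⟩] at this
  rw [← hnk, hφ.map_exp_nsmul hι hE, hz, hkx, hkz]
  simp

/-- On exponentials of real functions, `φ` is the evaluation at some point. -/
theorem exists_map_exp_eq_exp_eval [CompactSpace X] (hφ : IsMultiplicativeSpectral φ)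
    (hι : IsRegularFunctionAlgebra ι) (hE : ∀ f x, ι (E f) x = Complex.exp (ι f x)) :
    ∃ x, ∀ f : A, (∀ y, ((ι f y).re : ℂ) = ι f y) → φ (E f) = Complex.exp (ι f x) := by
  have hE0 : φ (E 0) = 1 := by
    obtain ⟨x, hx⟩ := hφ.exists_map_exp_eq hι hE 0
    simpa using hx
  obtain ⟨x, hx⟩ := exists_common_zero (ι := ι)
    (S := {f | φ (E f) = 1 ∧ IsNonnegFunction ι f})
    ⟨0, hE0, fun x => ⟨0, le_rfl, by simp⟩⟩ (fun f hf => hf.2)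
    (fun f hf g hg => ⟨by rw [hφ.map_exp_add hι hE, hf.1, hg.1, one_mul], hf.2.add hg.2⟩)
    (fun f hf => by
      obtain ⟨y, hy⟩ := hφ.exists_map_exp_eq hι hE f
      obtain ⟨r, -, hr⟩ := hf.2 y
      rw [hf.1, hr, ← Complex.ofReal_exp] at hy
      have : Real.exp r = 1 := by exact_mod_cast hy.symm
      exact ⟨y, by rw [hr, (Real.exp_eq_one_iff r).mp this, Complex.ofReal_zero]⟩)
  refine ⟨x, fun f hf => ?_⟩
  obtain ⟨y, hy⟩ := hφ.exists_map_exp_eq hι hE f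
  -- Subtracting the value at `y` normalises to `φ (exp g) = 1`. Squaring then puts `g ^ 2` in the
  -- nonnegative family, whose common zero is `x`.
  set c := algebraMap ℂ A (ι f y) with hc
  set g := f - c with hgdef
  have hgx (z : X) : ι g z = ι f z - ι f y := by simp [hgdef, hc, AlgHomClass.commutes]
  have hg (z : X) : ((ι g z).re : ℂ) = ι g z := by
    rw [hgx, Complex.sub_re, Complex.ofReal_sub, hf, hf]
  have hEc : φ (E c) = Complex.exp (ι f y) := by
    obtain ⟨z, hz⟩ := hφ.exists_map_exp_eq hι hE c
    rw [hz]
    simp [hc, AlgHomClass.commutes]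
  have hg1 : φ (E g) = 1 := by
    have := hφ.map_exp_add hι hE g c
    rw [hgdef, sub_add_cancel, hy, hEc, eq_comm] at this
    exact (mul_eq_right₀ (Complex.exp_ne_zero _)).mp this
  have h0 := hx (g ^ 2) ⟨hφ.map_exp_sq_eq_one hι hE hg hg1, fun z =>
    ⟨(ι g z).re ^ 2, sq_nonneg _, by rw [Complex.ofReal_pow, hg]; simp⟩⟩
  have h0' : ι f x - ι f y = 0 := by simpa [hgx] using h0
  rw [hy, sub_eq_zero.mp h0']

end Exp

/-! ### Continuity, and the equivalence -/

theorem exists_eq_eval_of_continuous [CompactSpace X] [TopologicalSpace A] [ContinuousAdd A]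
    [ContinuousSMul ℂ A] (hφ : IsMultiplicativeSpectral φ) (hι : IsRegularFunctionAlgebra ι)
    (hc : Continuous φ) : ∃ x, ∀ f, φ f = ι f x := by
  choose E hE using fun f : A =>
    hι.exists_comp f Complex.exp (Complex.locallyLipschitzOn_exp _)
  obtain ⟨x, hx⟩ := hφ.exists_map_exp_eq_exp_eval hι hE
  -- A nonnegative function may vanish and so have no logarithm in `A`; adding `ε` makes it the
  -- exponential of a real element.
  have hpos : ∀ e, IsNonnegFunction ι e → ∀ ε : ℝ, 0 < ε →
      φ (e + (ε : ℂ) • 1) = ι e x + ε := by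
    intro e he ε hε
    have hadd (y : X) : ι (e + (ε : ℂ) • 1) y = ι e y + ε := by
      rw [map_add, map_smul, _root_.map_one]
      simp only [ContinuousMap.add_apply, ContinuousMap.smul_apply, ContinuousMap.one_apply,
        smul_eq_mul, mul_one]
    have hval (y : X) : ∃ r : ℝ, 0 < r ∧ ι (e + (ε : ℂ) • 1) y = r := by
      obtain ⟨r, hr, hr'⟩ := he y
      exact ⟨r + ε, by positivity, by rw [hadd, hr', Complex.ofReal_add]⟩
    obtain ⟨l, hl⟩ := hι.exists_comp (e + (ε : ℂ) • 1) Complex.log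
      (Complex.locallyLipschitzOn_log (by
        rintro _ ⟨y, rfl⟩
        obtain ⟨r, hr, hr'⟩ := hval y
        rw [hr']
        exact Complex.ofReal_mem_slitPlane.mpr hr))
    have hexp (y : X) : Complex.exp (ι l y) = ι (e + (ε : ℂ) • 1) y := by
      obtain ⟨r, hr, hr'⟩ := hval y
      rw [hl, Complex.exp_log]
      rw [hr']
      exact_mod_cast hr.ne'
    have hEl : E l = e + (ε : ℂ) • 1 :=
      hι.injective (ContinuousMap.ext fun y => by rw [hE, hexp])
    have hreal (y : X) : ((ι l y).re : ℂ) = ι l y := by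
      obtain ⟨r, hr, hr'⟩ := hval y
      rw [hl, hr', ← Complex.ofReal_log hr.le, Complex.ofReal_re]
    rw [← hEl, hx l hreal, hexp, hadd]
  refine ⟨x, hφ.eq_eval hι fun e he he1 => ?_⟩
  have hlim : Filter.Tendsto (fun ε : ℝ => φ (e + (ε : ℂ) • 1)) (nhdsWithin 0 (Set.Ioi 0))
      (nhds (φ e)) := by
    have : Continuous fun ε : ℝ => φ (e + (ε : ℂ) • 1) := by fun_prop
    simpa using (this.tendsto 0).mono_left nhdsWithin_le_nhds
  have hlim' : Filter.Tendsto (fun ε : ℝ => φ (e + (ε : ℂ) • 1)) (nhdsWithin 0 (Set.Ioi 0))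
      (nhds (ι e x)) := by
    have : Continuous fun ε : ℝ => ι e x + (ε : ℂ) := by fun_prop
    refine Filter.Tendsto.congr' ?_
      (by simpa using (this.tendsto 0).mono_left (nhdsWithin_le_nhds (s := Set.Ioi 0)))
    filter_upwards [self_mem_nhdsWithin] with ε hε
    exact (hpos e he ε hε).symm
  rw [tendsto_nhds_unique hlim hlim', he1]
  exact one_ne_zero

/-- In a regular function algebra with a topology finer than that of uniform convergence, a
multiplicative spectral function is a character if and only if it is continuous, if and only if
`1` is not in the linear span of its kernel. -/
theorem tfae [CompactSpace X] [TopologicalSpace A] [ContinuousAdd A]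
    [ContinuousSMul ℂ A] (hφ : IsMultiplicativeSpectral φ) (hι : IsRegularFunctionAlgebra ι)
    (hιc : Continuous ι) :
    List.TFAE [IsCharacter φ, Continuous φ, (1 : A) ∉ Submodule.span ℂ {f | φ f = 0}] := by
  have hchar : (∃ x, ∀ f, φ f = ι f x) → IsCharacter φ := by
    rintro ⟨x, hx⟩
    exact ⟨by simp [hx], by simp [hx], by simp [hx], 1, by simp [hx]⟩
  have hcont : (∃ x, ∀ f, φ f = ι f x) → Continuous φ := by
    rintro ⟨x, hx⟩
    rw [funext hx]
    exact (continuous_eval_const x).comp hιc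
  have h13 : IsCharacter φ → (1 : A) ∉ Submodule.span ℂ {f | φ f = 0} := by
    intro h h1
    let L : A →ₗ[ℂ] ℂ := { toFun := φ, map_add' := h.map_add, map_smul' := h.map_smul }
    have : Submodule.span ℂ {f | φ f = 0} ≤ LinearMap.ker L :=
      Submodule.span_le.mpr fun f hf => hf
    have h0 : φ 1 = 0 := this h1
    exact one_ne_zero ((hφ.map_one hι).symm.trans h0)
  tfae_have 1 → 3 := h13
  tfae_have 3 → 2 := fun h => hcont (hφ.exists_eq_eval_of_one_notMem_span hι h)
  tfae_have 2 → 1 := fun h => hchar (hφ.exists_eq_eval_of_continuous hι h)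
  tfae_finish

end IsMultiplicativeSpectral

end FunctionAlgebra

/-! ### The three concrete algebras -/

section Instances

/-- Compactness of the range upgrades the local Lipschitz condition to a single constant, which is
what preserves `Lip` and `AC`. -/
theorem LocallyLipschitzOn.exists_continuousMap_comp {X : Type*} [TopologicalSpace X]
    [CompactSpace X] {h : ℂ → ℂ} {f : C(X, ℂ)} (hh : LocallyLipschitzOn (Set.range f) h) :
    ∃ g : C(X, ℂ), ∃ K : ℝ≥0, LipschitzOnWith K h (Set.range f) ∧ ∀ x, g x = h (f x) := by
  obtain ⟨K, hK⟩ := hh.exists_lipschitzOnWith_of_compact (isCompact_range f.continuous)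
  exact ⟨⟨fun x => h (f x), hK.continuousOn.comp_continuous f.continuous
    fun x => Set.mem_range_self x⟩, K, hK, fun _ => rfl⟩

theorem isRegularFunctionAlgebra_continuousMap (X : Type*) [TopologicalSpace X] [CompactSpace X]
    [T2Space X] : IsRegularFunctionAlgebra (AlgHom.id ℂ C(X, ℂ)) where
  injective := Function.injective_id
  exists_comp f h hh := by
    obtain ⟨g, -, -, hg⟩ := LocallyLipschitzOn.exists_continuousMap_comp hh
    exact ⟨g, hg⟩
  exists_separating x U hU := by
    obtain ⟨d, hd0, hd1, -⟩ := exists_continuous_zero_one_of_isClosed (isClosed_singleton (x := x))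
      isOpen_interior.isClosed_compl
      (Set.disjoint_singleton_left.mpr fun h => h (mem_interior_iff_mem_nhds.mpr hU))
    refine ⟨⟨fun y => (d y : ℂ), by fun_prop⟩, by simpa using hd0 rfl, fun y hy => ?_⟩
    have : d y = 1 := hd1 fun h => hy (interior_subset h)
    simp [this]

theorem exists_lipschitzWith_separating {X : Type*} [PseudoMetricSpace X] {x : X} {U : Set X}
    (hU : U ∈ nhds x) :
    ∃ (d : C(X, ℂ)) (K : ℝ≥0), LipschitzWith K d ∧ d x = 0 ∧ ∀ y ∉ U, 1 ≤ (d y).re := by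
  obtain ⟨r, hr, hrU⟩ := Metric.mem_nhds_iff.mp hU
  -- The separating function is the distance to `x` divided by the radius of a ball inside `U`.
  have hL : LipschitzWith (1 * (‖r⁻¹‖₊ * 1)) (fun y => ((r⁻¹ • dist y x : ℝ) : ℂ)) :=
    Complex.isometry_ofReal.lipschitz.comp
      ((lipschitzWith_smul r⁻¹).comp (LipschitzWith.dist_left x))
  refine ⟨⟨_, hL.continuous⟩, _, hL, by simp, fun y hy => ?_⟩
  have : r ≤ dist y x := by
    by_contra! h
    exact hy (hrU h)
  simp only [ContinuousMap.coe_mk, Complex.ofReal_re, smul_eq_mul]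
  rwa [inv_mul_eq_div, one_le_div hr]

/-- The inclusion of `Lip(X)` in `C(X)`. -/
noncomputable def Lip.incl (X : Type*) [MetricSpace X] [CompactSpace X] : Lip X →ₐ[ℂ] C(X, ℂ) :=
  (lipSubalgebra X).val

theorem Lip.isRegularFunctionAlgebra (X : Type*) [MetricSpace X] [CompactSpace X] :
    IsRegularFunctionAlgebra (Lip.incl X) where
  injective := Subtype.val_injective
  exists_comp f h hh := by
    obtain ⟨g, K, hK, hg⟩ := LocallyLipschitzOn.exists_continuousMap_comp hh
    obtain ⟨L, hL⟩ := f.2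
    refine ⟨⟨g, K * L, ?_⟩, hg⟩
    rw [← lipschitzOnWith_univ, funext hg]
    exact hK.comp hL.lipschitzOnWith fun x _ => Set.mem_range_self x
  exists_separating x U hU := by
    obtain ⟨d, K, hK, hd⟩ := exists_lipschitzWith_separating hU
    exact ⟨⟨d, K, hK⟩, hd⟩

theorem Lip.continuous_incl (X : Type*) [MetricSpace X] [CompactSpace X] :
    Continuous (Lip.incl X) := by
  refine AddMonoidHomClass.continuous_of_bound (Lip.incl X) 1 fun f => ?_
  rw [one_mul, Lip.norm_def]
  exact le_add_of_nonneg_right (NNReal.coe_nonneg _)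

theorem AbsolutelyContinuousOnInterval.comp_lipschitzOnWith {X Y : Type*} [PseudoMetricSpace X]
    [PseudoMetricSpace Y] {f : ℝ → X} {a b : ℝ} {h : X → Y} {K : ℝ≥0} {s : Set X}
    (hf : AbsolutelyContinuousOnInterval f a b) (hh : LipschitzOnWith K h s)
    (hs : ∀ t, f t ∈ s) : AbsolutelyContinuousOnInterval (fun t => h (f t)) a b := by
  -- The sums defining absolute continuity grow by at most the factor `K`.
  refine squeeze_zero (fun E => Finset.sum_nonneg fun i _ => dist_nonneg) (fun E => ?_)
    (by simpa using Filter.Tendsto.const_mul (K : ℝ) hf)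
  rw [Finset.mul_sum]
  exact Finset.sum_le_sum fun i _ => hh.dist_le_mul _ (hs _) _ (hs _)

/-- The inclusion of `AC([0, 1])` in `C([0, 1])`. -/
noncomputable def AC.incl : AC →ₐ[ℂ] C(Set.Icc (0 : ℝ) 1, ℂ) :=
  acSubalgebra.val

theorem AC.isRegularFunctionAlgebra : IsRegularFunctionAlgebra AC.incl where
  injective := Subtype.val_injective
  exists_comp f h hh := by
    obtain ⟨g, K, hK, hg⟩ := LocallyLipschitzOn.exists_continuousMap_comp hh
    refine ⟨⟨g, ?_⟩, hg⟩
    have hf : AbsolutelyContinuousOnInterval (Set.IccExtend zero_le_one f.1) 0 1 := f.2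
    have := hf.comp_lipschitzOnWith hK fun t => Set.mem_range_self _
    change AbsolutelyContinuousOnInterval (Set.IccExtend zero_le_one g) 0 1
    rwa [show Set.IccExtend zero_le_one g = fun t => h (Set.IccExtend zero_le_one f.1 t) from
      funext fun t => hg _]
  exists_separating x U hU := by
    obtain ⟨d, K, hK, hd⟩ := exists_lipschitzWith_separating hU
    exact ⟨⟨d, (hK.comp (LipschitzWith.projIcc zero_le_one)).lipschitzOnWith
      |>.absolutelyContinuousOnInterval⟩, hd⟩

theorem AC.continuous_incl : Continuous AC.incl := by
  refine AddMonoidHomClass.continuous_of_bound AC.incl 1 fun f => ?_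
  rw [one_mul, AC.norm_def]
  exact le_add_of_nonneg_right (totalVar_nonneg _)

end Instances

theorem corollary3p8 :
    (∀ (X : Type*) [TopologicalSpace X] [CompactSpace X] [T2Space X] (φ : C(X, ℂ) → ℂ),
      IsMultiplicativeSpectral φ →
      List.TFAE [IsCharacter φ, Continuous φ, (1 : C(X, ℂ)) ∉ Submodule.span ℂ {f | φ f = 0}]) ∧
    (∀ (X : Type*) [MetricSpace X] [CompactSpace X] (φ : Lip X → ℂ),
      IsMultiplicativeSpectral φ →
      List.TFAE [IsCharacter φ, Continuous φ, (1 : Lip X) ∉ Submodule.span ℂ {f | φ f = 0}]) ∧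
    (∀ φ : AC → ℂ,
      IsMultiplicativeSpectral φ →
      List.TFAE [IsCharacter φ, Continuous φ, (1 : AC) ∉ Submodule.span ℂ {f | φ f = 0}]) := by
  refine ⟨fun X _ _ _ φ hφ => ?_, fun X _ _ φ hφ => ?_, fun φ hφ => ?_⟩
  · exact hφ.tfae (isRegularFunctionAlgebra_continuousMap X) continuous_id
  · exact hφ.tfae (Lip.isRegularFunctionAlgebra X) (Lip.continuous_incl X)
  · exact hφ.tfae AC.isRegularFunctionAlgebra AC.continuous_incl
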